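/- Let $\mathbb K$ be a field of characteristic $0$ and let $X = X_{\bar 0}\sqcup X_{\bar 1}$ be a set whose elements are assigned parities $|x|\in\mathbb Z/2$. Let $(\mathrm{Zin}(X),\circ)$ be the free Zinbiel superalgebra over $\mathbb K$ on $X$, i.e. the free $\mathbb Z/2$-graded algebra on $X$ subject to $$a\circ(b\circ c)=(a\circ b)\circ c+(-1)^{|a||b|}(b\circ a)\circ c\qquad\text{for all homogeneous } a,b,c.$$ It has as a basis the nonempty words $x_1x_2\cdots x_n:=(\cdots(x_1\circ x_2)\circ\cdots)\circ x_n$ with $n\ge 1$ and $x_i\in X$; the product is determined by $u\circ y=uy$ and $u\circ (vy)=\big(u\circ v+(-1)^{|u||v|}\,v\circ u\big)\circ y$ for words $u,v$ and a letter $y$. The degree of a word is its number of letters, counting repetitions, and its parity is the sum of the parities of its letters. Let $[\cdot,\cdot]$ be the supercommutator on $\mathrm{Zin}(X)$, the bilinear operation with $[a,b]=a\circ b-(-1)^{|a||b|}\,b\circ a$ for $a,b$ homogeneous with respect to parity, and let $ST(X)\subseteq\mathrm{Zin}(X)$ be the free special Tortkara superalgebra on $X$, i.e. the smallest subspace that contains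 $X$ and is closed under $[\cdot,\cdot]$. Let $p:\mathrm{Zin}(X)\to\mathrm{Zin}(X)$ be the linear map with $$p(x)=-x,\qquad p(yz)=(-1)^{|y||z|}zy,\qquad p(wyz)=(-1)^{|y||z|}\,wzy$$ for letters $x,y,z\in X$ and nonempty words $w$. **Theorem.** Let $f\in\mathrm{Zin}(X)$ be homogeneous of degree $n>1$, that is, a linear combination of words of degree $n$. Then $f\in ST(X)$ if and only if $p(f)=-f$. -/

import Mathlib

namespace ZinbielSuper

/-- The sign `(-1)^{|a||b|}` for parities `i = |a|` and `j = |b|`. -/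
def sgn (K : Type*) [Field K] (i j : ZMod 2) : K := (-1) ^ (i * j).val

/-- A superalgebra `A = A₀ ⊕ A₁` (with an arbitrary bilinear multiplication `mul`) satisfying the
super Zinbiel identity `a (b c) = (a b) c + (-1)^{|a||b|} (b a) c` on homogeneous elements. -/
structure IsZinbielSuperalgebra {K A : Type*} [Field K] [AddCommGroup A] [Module K A]
    (gr : ZMod 2 → Submodule K A) (mul : A →ₗ[K] A →ₗ[K] A) : Prop where
  isCompl : IsCompl (gr 0) (gr 1)
  mul_mem : ∀ i j a b, a ∈ gr i → b ∈ gr j → mul a b ∈ gr (i + j)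
  zinbiel : ∀ i j k a b c, a ∈ gr i → b ∈ gr j → c ∈ gr k →
    mul a (mul b c) - mul (mul a b) c - sgn K i j • mul (mul b a) c = 0

/-- Nonempty words in the alphabet `X`; `snoc w x` is the word `w` followed by the letter `x`. -/
inductive Word (X : Type*) where
  | letter : X → Word X
  | snoc : Word X → X → Word X

namespace Word

variable {X : Type*}

/-- The degree of a word: its number of letters, counting repetitions. -/
def length : Word X → ℕ
  | letter _ => 1
  | snoc w _ => w.length + 1

/-- The parity of a word: the sum of the parities of its letters. -/
def parity (par : X → ZMod 2) : Word X → ZMod 2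
  | letter x => par x
  | snoc w x => w.parity par + par x

end Word

/-- The underlying space of the free Zinbiel superalgebra on `X`: its basis consists of the
nonempty words in `X`, where `x₁ x₂ ⋯ xₙ` is the left-bracketed product
`(⋯ (x₁ ∘ x₂) ⋯ ) ∘ xₙ`. -/
abbrev Zin (K X : Type*) [Field K] : Type _ := Word X →₀ K

section

variable (K : Type*) {X : Type*} [Field K]

/-- A word as a basis element. -/
noncomputable def word (w : Word X) : Zin K X := Finsupp.single w 1

/-- Appending the letter `x` to all words. -/
noncomputable def append (x : X) : Zin K X →ₗ[K] Zin K X :=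
  Finsupp.lmapDomain K K fun w => Word.snoc w x

/-- The product of two words: `u ∘ y = u y` for a letter `y`, and `u ∘ (v y) = (u ⧢ v) y`, where
`u ⧢ v = u ∘ v + (-1)^{|u||v|} v ∘ u` is the super shuffle product of nonempty words. -/
noncomputable def mulWord (par : X → ZMod 2) : Word X → Word X → Zin K X
  | u, .letter y => word K (.snoc u y)
  | u, .snoc v y =>
      append K y (mulWord par u v + sgn K (u.parity par) (v.parity par) • mulWord par v u)
  termination_by u v => u.length + v.length
  decreasing_by all_goals simp only [Word.length]; omega

/-- The product `∘` of the free Zinbiel superalgebra. -/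
noncomputable def mul (par : X → ZMod 2) : Zin K X →ₗ[K] Zin K X →ₗ[K] Zin K X :=
  Finsupp.linearCombination K fun u => Finsupp.linearCombination K fun v => mulWord K par u v

/-- The even (`i = 0`) and odd (`i = 1`) parts of the free Zinbiel superalgebra. -/
noncomputable def grading (par : X → ZMod 2) (i : ZMod 2) : Submodule K (Zin K X) :=
  Finsupp.supported K K {w | w.parity par = i}

/-- The supercommutator: the bilinear operation with `[a, b] = a ∘ b - (-1)^{|a||b|} b ∘ a` for
`a`, `b` homogeneous with respect to parity. -/
noncomputable def superCommutator (par : X → ZMod 2) : Zin K X →ₗ[K] Zin K X →ₗ[K] Zin K X :=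
  Finsupp.linearCombination K fun u => Finsupp.linearCombination K fun v =>
    mulWord K par u v - sgn K (u.parity par) (v.parity par) • mulWord K par v u

/-- The free special Tortkara superalgebra: the subalgebra generated by `X` under the
supercommutator, that is, the least subspace containing `X` and closed under the supercommutator.
It is automatically a graded subspace since the generators are homogeneous. -/
noncomputable def ST (par : X → ZMod 2) : Submodule K (Zin K X) :=
  sInf {S | (∀ x, word K (.letter x) ∈ S) ∧
    ∀ a b, a ∈ S → b ∈ S → superCommutator K par a b ∈ S}

/-- The map `p` on words. -/
noncomputable def pWord (par : X → ZMod 2) : Word X → Zin K X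
  | .letter x => -word K (.letter x)
  | .snoc (.letter x) y => sgn K (par x) (par y) • word K (.snoc (.letter y) x)
  | .snoc (.snoc w y) z => sgn K (par y) (par z) • word K (.snoc (.snoc w z) y)

/-- The linear map `p` swapping, with sign, the last two letters of every word. -/
noncomputable def p (par : X → ZMod 2) : Zin K X →ₗ[K] Zin K X :=
  Finsupp.linearCombination K (pWord K par)

/-- The elements which are homogeneous of degree `n`: combinations of words with `n` letters. -/
def IsHomogeneousOfDegree {K : Type*} [Field K] (f : Zin K X) (n : ℕ) : Prop :=
  ∀ w ∈ f.support, w.length = n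

/-! Sanity: `Zin K X` with `mul` and `grading` is a free Zinbiel superalgebra on `X`. -/

lemma sgn_mul_self (i j : ZMod 2) : sgn K i j * sgn K i j = 1 := by
  rw [sgn, ← pow_add, ← two_mul, pow_mul]; simp

lemma sgn_comm (i j : ZMod 2) : sgn K i j = sgn K j i := by rw [sgn, sgn, mul_comm]

lemma sgn_add_right (i j k : ZMod 2) : sgn K i (j + k) = sgn K i j * sgn K i k := by
  rw [sgn, sgn, sgn, ← pow_add, neg_one_pow_eq_pow_mod_two, neg_one_pow_eq_pow_mod_two (n := _ + _)]
  congr 1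
  revert i j k; decide

lemma sgn_add_left (i j k : ZMod 2) : sgn K (i + j) k = sgn K i k * sgn K j k := by
  rw [sgn_comm, sgn_add_right, sgn_comm K k i, sgn_comm K k j]

lemma mul_word (par : X → ZMod 2) (u v : Word X) :
    mul K par (word K u) (word K v) = mulWord K par u v := by
  simp [mul, word, Finsupp.linearCombination_single]

lemma append_word (x : X) (w : Word X) : append K x (word K w) = word K (.snoc w x) := by
  simp [append, word, Finsupp.mapDomain_single]

lemma lin_ext {M : Type*} [AddCommGroup M] [Module K M] {F G : Zin K X →ₗ[K] M}
    (h : ∀ w, F (word K w) = G (word K w)) : F = G :=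
  Finsupp.lhom_ext' fun w => LinearMap.ext_ring (h w)

lemma word_mem (par : X → ZMod 2) (w : Word X) : word K w ∈ grading K par (w.parity par) :=
  Finsupp.single_mem_supported K 1 rfl

lemma append_mem (par : X → ZMod 2) (x : X) (i : ZMod 2) (a : Zin K X)
    (ha : a ∈ grading K par i) : append K x a ∈ grading K par (i + par x) := by
  rw [grading, Finsupp.supported_eq_span_single] at ha
  induction ha using Submodule.span_induction with
  | mem a h =>
    obtain ⟨w, hw, rfl⟩ := h
    have := word_mem K par (.snoc w x)
    rw [← append_word] at this
    rw [← (show w.parity par = i from hw)]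
    exact this
  | zero => simp
  | add a b _ _ h1 h2 => rw [map_add]; exact add_mem h1 h2
  | smul c a _ h => rw [map_smul]; exact Submodule.smul_mem _ c h

lemma mulWord_mem (par : X → ZMod 2) (u v : Word X) :
    mulWord K par u v ∈ grading K par (u.parity par + v.parity par) := by
  induction hn : u.length + v.length using Nat.strong_induction_on generalizing u v with
  | _ n ih =>
    cases v with
    | letter y => rw [mulWord]; exact word_mem K par (.snoc u y)
    | snoc v y =>
      rw [mulWord, Word.parity, ← add_assoc]
      simp only [Word.length] at hn
      refine append_mem K par y _ _ (add_mem (ih _ ?_ u v rfl) (Submodule.smul_mem _ _ ?_))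
      · omega
      · rw [add_comm]; exact ih _ (by omega) v u rfl

/-- Extending a property of a graded piece from words by linearity. -/
lemma grading_induction (par : X → ZMod 2) (i : ZMod 2) (P : Zin K X → Prop)
    (hw : ∀ w : Word X, w.parity par = i → P (word K w)) (h0 : P 0)
    (hadd : ∀ a b, P a → P b → P (a + b)) (hsmul : ∀ (c : K) a, P a → P (c • a))
    (a : Zin K X) (ha : a ∈ grading K par i) : P a := by
  rw [grading, Finsupp.supported_eq_span_single] at ha
  induction ha using Submodule.span_induction with
  | mem a h => obtain ⟨w, h, rfl⟩ := h; exact hw w h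
  | zero => exact h0
  | add a b _ _ h1 h2 => exact hadd a b h1 h2
  | smul c a _ h => exact hsmul c a h

lemma mul_snoc (par : X → ZMod 2) (a : Zin K X) (i : ZMod 2) (ha : a ∈ grading K par i)
    (b : Zin K X) (j : ZMod 2) (hb : b ∈ grading K par j) (y : X) :
    mul K par a (append K y b) = append K y (mul K par a b + sgn K i j • mul K par b a) := by
  revert b
  refine grading_induction K par j _ ?_ (by simp) ?_ ?_
  · intro v hv
    revert a
    refine grading_induction K par i _ ?_ (by simp) ?_ ?_
    · intro u hu
      rw [append_word, mul_word, mul_word, mul_word, mulWord, hu, hv]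
    · intro a b h1 h2
      simp only [map_add, LinearMap.add_apply, h1, h2, smul_add]; abel
    · intro c a h
      simp only [map_smul, LinearMap.smul_apply, h, map_add, smul_add, smul_comm c]
  · intro a b h1 h2
    simp only [map_add, LinearMap.add_apply, h1, h2, smul_add]; abel
  · intro c a h
    simp only [map_smul, LinearMap.smul_apply, h, map_add, smul_add, smul_comm c]

lemma mul_mem' (par : X → ZMod 2) (i j : ZMod 2) (a b : Zin K X) (ha : a ∈ grading K par i)
    (hb : b ∈ grading K par j) : mul K par a b ∈ grading K par (i + j) := by
  revert b
  refine grading_induction K par j _ ?_ (by simp) ?_ ?_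
  · intro v hv
    revert a
    refine grading_induction K par i _ ?_ (by simp) ?_ ?_
    · intro u hu
      rw [mul_word, ← hu, ← hv]; exact mulWord_mem K par u v
    · intro a b h1 h2
      rw [map_add, LinearMap.add_apply]; exact add_mem h1 h2
    · intro c a h
      rw [map_smul, LinearMap.smul_apply]; exact Submodule.smul_mem _ c h
  · intro a b h1 h2
    rw [map_add]; exact add_mem h1 h2
  · intro c a h
    rw [map_smul]; exact Submodule.smul_mem _ c h

lemma zinbiel_word (par : X → ZMod 2) (u v w : Word X) :
    mul K par (word K u) (mulWord K par v w) = mul K par (mulWord K par u v) (word K w) +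
      sgn K (u.parity par) (v.parity par) • mul K par (mulWord K par v u) (word K w) := by
  induction hn : u.length + v.length + w.length using Nat.strong_induction_on
    generalizing u v w with
  | _ n ih =>
    have hm := mulWord_mem K par
    have hwd := word_mem (K := K) par
    cases w with
    | letter z =>
      rw [mulWord, ← append_word, mul_snoc K par _ _ (hwd u) _ _ (hwd v), mul_word, mul_word,
        map_add, map_smul]
      congr 1
      · have : ∀ a : Zin K X, append K z a = mul K par a (word K (.letter z)) := by
          intro a
          have h : append K z = (mul K par).flip (word K (.letter z)) := lin_ext K fun x => by
            rw [LinearMap.flip_apply, append_word, mul_word, mulWord]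
          rw [h]; rfl
        exact this _
      · have : ∀ a : Zin K X, append K z a = mul K par a (word K (.letter z)) := by
          intro a
          have h : append K z = (mul K par).flip (word K (.letter z)) := lin_ext K fun x => by
            rw [LinearMap.flip_apply, append_word, mul_word, mulWord]
          rw [h]; rfl
        rw [this]
    | snoc w z =>
      simp only [Word.length] at hn
      have hvw : mulWord K par v w + sgn K (v.parity par) (w.parity par) • mulWord K par w v ∈
          grading K par (v.parity par + w.parity par) :=
        add_mem (hm v w) (Submodule.smul_mem _ _ (by rw [add_comm]; exact hm w v))
      have e1 := ih _ (by omega) u v w rfl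
      have e2 := ih _ (by omega) u w v rfl
      have e4 := ih _ (by omega) w u v rfl
      have e5 := ih _ (by omega) w v u rfl
      have huv := mul_snoc K par _ _ (hm u v) _ _ (hwd w) z
      have hvu := mul_snoc K par _ _ (hm v u) _ _ (hwd w) z
      rw [mulWord, mul_snoc K par _ _ (hwd u) _ _ hvw, ← append_word, huv, hvu,
        ← map_smul (append K z), ← map_add (append K z)]
      congr 1
      simp only [map_add, map_smul, LinearMap.add_apply, LinearMap.smul_apply, e1, e2, e4, e5,
        smul_add, sgn_add_right, sgn_add_left, smul_smul]
      simp only [sgn_comm K (w.parity par)]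
      have h1 := sgn_mul_self K (u.parity par) (v.parity par)
      have h2 := sgn_mul_self K (u.parity par) (w.parity par)
      have h3 := sgn_mul_self K (v.parity par) (w.parity par)
      generalize sgn K (u.parity par) (v.parity par) = a at *
      generalize sgn K (u.parity par) (w.parity par) = b at *
      generalize sgn K (v.parity par) (w.parity par) = c at *
      match_scalars <;> grind

/-- `Zin K X` is a Zinbiel superalgebra. -/
theorem isZinbielSuperalgebra (par : X → ZMod 2) :
    IsZinbielSuperalgebra (grading K par) (mul K par) where
  isCompl := by
    have h : {w : Word X | w.parity par = 1} = {w : Word X | w.parity par = 0}ᶜ := by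
      ext w
      simp only [Set.mem_ofPred_eq, Set.mem_compl_iff]
      generalize w.parity par = i
      revert i; decide
    rw [grading, grading, h]
    exact ⟨Finsupp.disjoint_supported_supported disjoint_compl_right,
      Finsupp.codisjoint_supported_supported isCompl_compl.codisjoint⟩
  mul_mem := mul_mem' K par
  zinbiel := by
    intro i j k a b c ha hb _
    revert a
    refine grading_induction K par i _ ?_ (by simp) ?_ ?_
    · intro u hu
      revert b
      refine grading_induction K par j _ ?_ (by simp) ?_ ?_
      · intro v hv
        have h : (mul K par (word K u)).comp (mul K par (word K v)) =
            mul K par (mulWord K par u v) + sgn K i j • mul K par (mulWord K par v u) :=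
          lin_ext K fun w => by
            rw [← hu, ← hv]
            simpa [mul_word] using zinbiel_word K par u v w
        have h' := LinearMap.congr_fun h c
        simp only [LinearMap.comp_apply, LinearMap.add_apply, LinearMap.smul_apply] at h'
        rw [mul_word, mul_word, h']; abel
      · intro a b h1 h2
        simp only [map_add, LinearMap.add_apply, smul_add]
        have h3 := congrArg₂ (· + ·) h1 h2
        simp only [add_zero] at h3
        rw [← h3]; abel
      · intro r a h
        simp only [map_smul, LinearMap.smul_apply]
        rw [smul_comm (sgn K i j), ← smul_sub, ← smul_sub, h, smul_zero]
    · intro a b h1 h2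
      simp only [map_add, LinearMap.add_apply, smul_add]
      have h3 := congrArg₂ (· + ·) h1 h2
      simp only [add_zero] at h3
      rw [← h3]; abel
    · intro r a h
      simp only [map_smul, LinearMap.smul_apply]
      rw [smul_comm (sgn K i j), ← smul_sub, ← smul_sub, h, smul_zero]

/-- `Zin K X` is free: every parity-preserving map from `X` to a Zinbiel superalgebra extends
uniquely to a homomorphism of superalgebras. -/
theorem existsUnique_hom (par : X → ZMod 2) {A : Type*} [AddCommGroup A] [Module K A]
    (gr : ZMod 2 → Submodule K A) (m : A →ₗ[K] A →ₗ[K] A) (hA : IsZinbielSuperalgebra gr m)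
    (g : X → A) (hg : ∀ x, g x ∈ gr (par x)) :
    ∃! F : Zin K X →ₗ[K] A, (∀ x, F (word K (.letter x)) = g x) ∧
      (∀ i a, a ∈ grading K par i → F a ∈ gr i) ∧
      ∀ a b, F (mul K par a b) = m (F a) (F b) := by
  let F0 : Word X → A := fun w => Word.rec (fun x => g x) (fun _ x r => m r (g x)) w
  let F : Zin K X →ₗ[K] A := Finsupp.linearCombination K F0
  have hF : ∀ w, F (word K w) = F0 w := fun w => by simp [F, word]
  have hFa : ∀ y a, F (append K y a) = m (F a) (g y) := fun y a => by
    have h : F.comp (append K y) = (m.flip (g y)).comp F := lin_ext K fun w => by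
      rw [LinearMap.comp_apply, append_word, LinearMap.comp_apply, LinearMap.flip_apply, hF, hF]
    exact LinearMap.congr_fun h a
  have hF0 : ∀ w, F0 w ∈ gr (w.parity par) := by
    intro w
    induction w with
    | letter x => exact hg x
    | snoc w x ih => exact hA.mul_mem _ _ _ _ ih (hg x)
  have hFm : ∀ u v, F (mulWord K par u v) = m (F0 u) (F0 v) := by
    intro u v
    induction hn : u.length + v.length using Nat.strong_induction_on generalizing u v with
    | _ n ih =>
      cases v with
      | letter y => rw [mulWord, hF]
      | snoc v y =>
        simp only [Word.length] at hn
        have hz := hA.zinbiel _ _ _ _ _ _ (hF0 u) (hF0 v) (hg y)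
        rw [mulWord, hFa, map_add, map_smul, ih _ (by omega) u v rfl, ih _ (by omega) v u rfl,
          map_add, map_smul, LinearMap.add_apply, LinearMap.smul_apply]
        rw [sub_sub, sub_eq_zero] at hz
        exact hz.symm
  refine ⟨F, ⟨fun x => hF _, fun i => ?_, fun a b => ?_⟩, ?_⟩
  · refine grading_induction K par i _ ?_ (by simp) ?_ ?_
    · intro w hw
      rw [hF, ← hw]; exact hF0 w
    · intro a b h1 h2
      rw [map_add]; exact add_mem h1 h2
    · intro c a h
      rw [map_smul]; exact Submodule.smul_mem _ c h
  · have h : (mul K par).compr₂ F = m.compl₁₂ F F := lin_ext K fun u => lin_ext K fun v => by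
      rw [LinearMap.compr₂_apply, LinearMap.compl₁₂_apply, mul_word, hF, hF, hFm]
    exact LinearMap.congr_fun (LinearMap.congr_fun h a) b
  · rintro G ⟨hG1, -, hG2⟩
    refine lin_ext K fun w => ?_
    rw [hF]
    induction w with
    | letter x => exact hG1 x
    | snoc w x ih =>
      have h := hG2 (word K w) (word K (.letter x))
      rw [mul_word, mulWord, ih, hG1] at h
      exact h

end

end ZinbielSuper

/-!
The elements of `ST` satisfy `p f = -f` because `p + 1` kills letters and its kernel is closed under
the supercommutator: in `[u, v]` the terms whose last two letters come from different factors occur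
in antisymmetric pairs, so `(p + 1) [f, g]` depends only on `(p + 1) f` and `(p + 1) g`
(`p_superCommutator_add`).

Conversely, `p f = -f` gives `2 f = f - p f`, so it suffices that every antisymmetrized word
`⟨w | a, b⟩ = w a b - (-1)^{|a||b|} w b a` lies in `ST` (`antisymm_mem_ST`). This goes by induction
on the length; brackets with single letters suffice. Up to signs,
`[⟨w | a, b⟩, x] = ⟨w a | b, x⟩ + ⟨w b | x, a⟩ - ⟨x ⧢ w | a, b⟩`
(`superCommutator_antisymm_letter`), so modulo `ST` the antisymmetrized words of the next length
satisfy
`⟨x ⧢ w | a, b⟩ = ⟨w a | b, x⟩ + ⟨w b | x, a⟩`. (∗)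
After labelling the letters of a word by their positions, the signs are removed by multiplying with
Koszul signs (`ins_koszul_cons_cons`), and it remains to show that a function on words with distinct
letters vanishes if it is alternating in the last two letters and satisfies (∗)
(`eq_zero_of_insertion_relation`).

To this end one shows `⟨S ⧢ w | a, b⟩ = 0` for every word `w` and every nonempty set `S` of letters,
all of which are shuffled into `w`, by induction on `w` (`shuffleIns_eq_zero`). If this holds for
`w`, then (∗) makes `⟨(S ⧢ w) y | a, b⟩` invariant under rotation of `y, a, b` and equal to the sum
of its rotations up to a vanishing term, hence zero (`shuffleIns_eq_zero_of_insert`); for `S = ∅`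
this is the claim wanted in the end. Consequently, in `⟨S ⧢ (w y) | a, b⟩` only the shuffles ending
in a letter of `S` contribute. For the elements `a, b` of a fixed set `L = S ∪ {a, b}` these
expressions then satisfy a linear system which has only the zero solution in characteristic `0`
(`eq_zero_of_cyclic_relations`).
-/

namespace ZinbielSuper

/-! ### Insertion operators -/

section Insertion

variable {K Y M : Type*} [Field K] [AddCommGroup M] [Module K M]

/-- The weighted sum of `F` over all lists obtained by inserting `x` into a list. Lists are read
as words from right to left (the head is the last letter), and the insertion of `x` carries the
weight `∏ s x c` over the letters `c` to the right of `x` in the word. -/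
def ins (s : Y → Y → K) (x : Y) : (List Y → M) → List Y → M
  | F, [] => F [x]
  | F, y :: w => F (x :: y :: w) + s x y • ins s x (fun l => F (y :: l)) w

lemma ins_congr (s : Y → Y → K) (x : Y) (F G : List Y → M) (w : List Y)
    (h : ∀ l, l.Perm (x :: w) → F l = G l) : ins s x F w = ins s x G w := by
  induction w generalizing F G with
  | nil => exact h _ (List.Perm.refl _)
  | cons y w ih =>
    simp only [ins]
    rw [h _ (List.Perm.refl _), ih (fun l => F (y :: l)) (fun l => G (y :: l)) fun l hl =>
        h _ ((hl.cons y).trans (List.Perm.swap x y w))]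

lemma ins_map {M' : Type*} [AddCommGroup M'] [Module K M'] (s : Y → Y → K) (x : Y)
    (T : M →ₗ[K] M') (F : List Y → M) (w : List Y) :
    ins s x (fun l => T (F l)) w = T (ins s x F w) := by
  induction w generalizing F with
  | nil => rfl
  | cons y w ih => simp only [ins, map_add, map_smul, ih fun l => F (y :: l)]

lemma ins_comp_map {X : Type*} (s : X → X → K) (ℓ : Y → X) (x : Y) (F : List X → M)
    (w : List Y) :
    ins (fun a b => s (ℓ a) (ℓ b)) x (fun l => F (l.map ℓ)) w = ins s (ℓ x) F (w.map ℓ) := by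
  induction w generalizing F with
  | nil => rfl
  | cons y w ih =>
    simp only [ins, List.map_cons]
    rw [← ih fun l => F (ℓ y :: l)]

lemma ins_add (s : Y → Y → K) (x : Y) (F G : List Y → M) (w : List Y) :
    ins s x (F + G) w = ins s x F w + ins s x G w := by
  induction w generalizing F G with
  | nil => rfl
  | cons y w ih =>
    have h := ih (fun l => F (y :: l)) (fun l => G (y :: l))
    simp only [ins, Pi.add_apply]
    rw [show (fun l => F (y :: l) + G (y :: l)) = (fun l => F (y :: l)) + fun l => G (y :: l)
      from rfl, h, smul_add]
    abel

end Insertion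

section Unweighted

variable (K : Type*) {Y M : Type*} [Field K] [AddCommGroup M] [Module K M]

/-- The sum of `F` over all insertions of `x` into a list, with all weights equal to `1`. -/
abbrev ins₁ (x : Y) (F : List Y → M) : List Y → M := ins (fun _ _ => (1 : K)) x F

lemma ins₁_comm (x y : Y) (F : List Y → M) :
    ins₁ K x (ins₁ K y F) = ins₁ K y (ins₁ K x F) := by
  funext w
  induction w generalizing F with
  | nil => simp only [ins, one_smul]; abel
  | cons z w ih =>
    have h (u v : Y) : ins₁ K u (ins₁ K v F) (z :: w) =
        F (v :: u :: z :: w) + F (u :: v :: z :: w) + ins₁ K v (fun l => F (u :: z :: l)) w +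
          ins₁ K u (fun l => F (v :: z :: l)) w +
          ins₁ K u (ins₁ K v fun l => F (z :: l)) w := by
      have e : (fun l => ins₁ K v F (z :: l)) =
          (fun l => F (v :: z :: l)) + ins₁ K v fun l => F (z :: l) := by
        funext l; simp [ins]
      simp only [ins₁, ins, one_smul] at e ⊢
      rw [e, ins_add]
      abel
    rw [h, h, ih]
    abel

lemma ins₁_sum {ι : Type*} (x : Y) (t : Finset ι) (F : ι → List Y → M) (w : List Y) :
    ins₁ K x (fun l => ∑ i ∈ t, F i l) w = ∑ i ∈ t, ins₁ K x (F i) w := by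
  classical
  induction t using Finset.induction_on with
  | empty =>
    have h := ins_add (fun _ _ => (1 : K)) x (0 : List Y → M) 0 w
    rw [add_zero, left_eq_add] at h
    simp only [Finset.sum_empty]
    exact h
  | insert i t hi ih =>
    simp only [Finset.sum_insert hi, ← ih]
    exact ins_add _ _ _ _ _

instance : LeftCommutative (ins₁ K : Y → (List Y → M) → List Y → M) := ⟨ins₁_comm K⟩

/-- The sum of `F` over all lists obtained by shuffling all arrangements of the elements of `S`
into a list. -/
def shuffleIns (S : Finset Y) (F : List Y → M) : List Y → M := S.val.foldr (ins₁ K) F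

@[simp] lemma shuffleIns_empty (F : List Y → M) : shuffleIns K ∅ F = F := rfl

variable [DecidableEq Y]

lemma shuffleIns_insert {x : Y} {S : Finset Y} (hx : x ∉ S) (F : List Y → M) :
    shuffleIns K (insert x S) F = ins₁ K x (shuffleIns K S F) := by
  rw [shuffleIns, Finset.insert_val_of_notMem hx, Multiset.foldr_cons]; rfl

lemma shuffleIns_ins {x : Y} {S : Finset Y} (hx : x ∉ S) (F : List Y → M) :
    shuffleIns K S (ins₁ K x F) = shuffleIns K (insert x S) F := by
  rw [shuffleIns_insert K hx]
  induction S using Finset.induction_on with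
  | empty => rfl
  | insert y S hy ih =>
    rw [Finset.mem_insert, not_or] at hx
    rw [shuffleIns_insert K hy, shuffleIns_insert K hy, ih hx.2, ins₁_comm]

lemma shuffleIns_add (S : Finset Y) (F G : List Y → M) :
    shuffleIns K S (F + G) = shuffleIns K S F + shuffleIns K S G := by
  induction S using Finset.induction_on with
  | empty => rfl
  | insert y S hy ih =>
    simp only [shuffleIns_insert K hy, ih]
    funext w
    exact ins_add _ _ _ _ _

lemma shuffleIns_neg (S : Finset Y) (F : List Y → M) :
    shuffleIns K S (-F) = -shuffleIns K S F := by
  have h := shuffleIns_add K S F (-F)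
  have h0 := shuffleIns_add K S (0 : List Y → M) 0
  rw [add_zero, left_eq_add] at h0
  rw [add_neg_cancel, h0] at h
  exact (neg_eq_of_add_eq_zero_right h.symm).symm

/-- Splitting the shuffles of `S` into a word `w y` according to their last letter, which is
either `y` or an element of `S`. -/
lemma shuffleIns_cons (S : Finset Y) (F : List Y → M) (y : Y) (w : List Y) :
    shuffleIns K S F (y :: w) = shuffleIns K S (fun l => F (y :: l)) w +
      ∑ x ∈ S, shuffleIns K (S.erase x) (fun l => F (x :: l)) (y :: w) := by
  induction S using Finset.induction_on generalizing y w with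
  | empty => simp
  | insert z S hz ih =>
    have e : (fun l => shuffleIns K S F (y :: l)) = (shuffleIns K S fun l => F (y :: l)) +
        fun l => ∑ x ∈ S, shuffleIns K (S.erase x) (fun l => F (x :: l)) (y :: l) := by
      funext l; exact ih y l
    have h : ∀ x ∈ S, shuffleIns K ((insert z S).erase x) (fun l => F (x :: l)) (y :: w) =
        shuffleIns K (S.erase x) (fun l => F (x :: l)) (z :: y :: w) +
          ins₁ K z (fun l => shuffleIns K (S.erase x) (fun l => F (x :: l)) (y :: l)) w := by
      intro x hx
      rw [Finset.erase_insert_of_ne (by rintro rfl; exact hz hx), shuffleIns_insert K (by simp [hz])]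
      simp only [ins₁, ins, one_smul]
    rw [Finset.sum_insert hz, Finset.sum_congr rfl h, Finset.sum_add_distrib, ← ins₁_sum,
      Finset.erase_insert hz, shuffleIns_insert K hz, shuffleIns_insert K hz]
    simp only [ins₁, ins, one_smul]
    rw [e, ins_add, ih z (y :: w)]
    abel

/-- The last letter of a shuffle of the elements of a nonempty `S` with the empty word. -/
lemma shuffleIns_nil {S : Finset Y} (hS : S.Nonempty) (F : List Y → M) :
    shuffleIns K S F [] = ∑ x ∈ S, shuffleIns K (S.erase x) (fun l => F (x :: l)) [] := by
  obtain ⟨z, hz⟩ := hS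
  obtain ⟨S, hz', rfl⟩ : ∃ T, z ∉ T ∧ insert z T = S :=
    ⟨S.erase z, Finset.notMem_erase z S, Finset.insert_erase hz⟩
  have h : ∀ x ∈ S, shuffleIns K ((insert z S).erase x) (fun l => F (x :: l)) [] =
      shuffleIns K (S.erase x) (fun l => F (x :: l)) [z] := by
    intro x hx
    rw [Finset.erase_insert_of_ne (by rintro rfl; exact hz' hx), shuffleIns_insert K (by simp [hz'])]
    rfl
  rw [Finset.sum_insert hz', Finset.sum_congr rfl h, Finset.erase_insert hz',
    shuffleIns_insert K hz', ← shuffleIns_cons]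
  rfl

end Unweighted

/-! ### Vanishing from the insertion relation -/

section Vanishing

variable (K : Type*) {Y M : Type*} [Field K] [CharZero K] [AddCommGroup M] [Module K M]
  [DecidableEq Y]

include K in
/-- A linear system with only the zero solution: `g x a b` is recovered from `G` by
`2 g x a b = G b x + G x a - G a b`, whence `k G a b = r b - r a` for the row sums `r` of `G`,
where `k + 2` is the size of `L`; summing over `b` gives `(2 k + 2) r a = 0`. -/
lemma eq_zero_of_cyclic_relations (L : Finset Y) (k : ℕ) (hk : k ≠ 0) (hL : L.card = k + 2)
    (G : Y → Y → M) (g : Y → Y → Y → M) (hG : ∀ a b, G a b = -G b a)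
    (hsum : ∀ a ∈ L, ∀ b ∈ L, a ≠ b → G a b = ∑ x ∈ (L.erase a).erase b, g x a b)
    (hcyc : ∀ a ∈ L, ∀ b ∈ L, ∀ x ∈ L, a ≠ b → b ≠ x → x ≠ a → G a b = g a b x + g b x a) :
    ∀ a ∈ L, ∀ b ∈ L, G a b = 0 := by
  have cancel (c : ℕ) (hc : c ≠ 0) (v : M) (h : c • v = 0) : v = 0 := by
    rw [← Nat.cast_smul_eq_nsmul K, smul_eq_zero] at h
    exact h.resolve_left (Nat.cast_ne_zero.2 hc)
  have hG0 (a : Y) : G a a = 0 :=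
    cancel 2 two_ne_zero _ (by rw [two_smul]; nth_rw 1 [hG]; exact neg_add_cancel _)
  set r : Y → M := fun a => ∑ x ∈ L, G a x with hr
  have hrow : ∀ a ∈ L, ∀ b ∈ L, k • G a b = r b - r a := by
    intro a ha b hb
    rcases eq_or_ne a b with rfl | hab
    · rw [hG0, smul_zero, sub_self]
    have hb' : b ∈ L.erase a := Finset.mem_erase.2 ⟨hab.symm, hb⟩
    have hcard : ((L.erase a).erase b).card = k := by
      rw [Finset.card_erase_of_mem hb', Finset.card_erase_of_mem ha, hL]; rfl
    have hg : 2 • G a b = ∑ x ∈ (L.erase a).erase b, (G b x - G a x - G a b) := by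
      rw [hsum a ha b hb hab, Finset.smul_sum, ← hsum a ha b hb hab]
      refine Finset.sum_congr rfl fun x hx => ?_
      simp only [Finset.mem_erase] at hx
      obtain ⟨hxb, hxa, hxL⟩ := hx
      rw [hG a x, hcyc a ha b hb x hxL hab hxb.symm hxa, hcyc b hb x hxL a ha hxb.symm hxa hab,
        hcyc x hxL a ha b hb hxa hab hxb.symm]
      abel
    have hsplit (F : Y → M) : ∑ x ∈ (L.erase a).erase b, F x = ∑ x ∈ L, F x - F a - F b := by
      rw [← Finset.add_sum_erase L F ha, ← Finset.add_sum_erase _ F hb']; abel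
    rw [Finset.sum_sub_distrib, Finset.sum_sub_distrib, Finset.sum_const, hcard, hsplit, hsplit,
      hG0, hG0, hG b a, two_smul] at hg
    have : k • G a b = (∑ x ∈ L, G b x - -G a b - 0 - (∑ x ∈ L, G a x - 0 - G a b)) -
      (G a b + G a b) := by rw [hg]; abel
    rw [this, hr]
    abel
  have hr0 : ∑ b ∈ L, r b = 0 := by
    refine cancel 2 two_ne_zero _ ?_
    rw [two_smul]
    have h : ∑ b ∈ L, r b = ∑ b ∈ L, ∑ x ∈ L, G x b := Finset.sum_comm
    nth_rw 1 [h]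
    rw [← Finset.sum_add_distrib]
    refine Finset.sum_eq_zero fun b _ => ?_
    rw [hr, ← Finset.sum_add_distrib]
    exact Finset.sum_eq_zero fun x _ => by rw [hG]; exact neg_add_cancel _
  have hra : ∀ a ∈ L, r a = 0 := by
    intro a ha
    have h := Finset.sum_congr rfl (hrow a ha)
    rw [← Finset.smul_sum, Finset.sum_sub_distrib, hr0, Finset.sum_const, hL] at h
    refine cancel (k + (k + 2)) (by omega) _ ?_
    rw [add_smul]
    nth_rw 1 [show r a = ∑ x ∈ L, G a x from rfl]
    rw [h]
    abel
  intro a ha b hb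
  exact cancel k hk _ (by rw [hrow a ha b hb, hra a ha, hra b hb, sub_self])

variable (φ : List Y → M) (hanti : ∀ a b w, φ (b :: a :: w) = -φ (a :: b :: w))
  (hrel : ∀ a b x w, ins₁ K x (fun l => φ (b :: a :: l)) w =
    φ (x :: b :: a :: w) + φ (a :: x :: b :: w))

include hanti hrel in
/-- If, for every way of splitting `S ∪ {a, b}` into a set `T` and two letters `a'`, `b'`, only the
shuffles of `T` into `w` that end in a letter of `T` contribute, then all these contributions are
zero. -/
lemma shuffleIns_eq_zero_of_split (w : List Y) (S : Finset Y) (a b : Y) (hS : S.Nonempty)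
    (ha : a ∉ S) (hb : b ∉ S) (hab : a ≠ b)
    (hsplit : ∀ (T : Finset Y) (a' b' : Y), T.Nonempty → a' ∉ T → b' ∉ T → a' ≠ b' →
      insert a' (insert b' T) = insert a (insert b S) →
      shuffleIns K T (fun l => φ (b' :: a' :: l)) w =
        ∑ x ∈ T, shuffleIns K (T.erase x) (fun l => φ (b' :: a' :: x :: l)) w) :
    shuffleIns K S (fun l => φ (b :: a :: l)) w = 0 := by
  set L := insert a (insert b S) with hL
  have hcard : L.card = S.card + 2 := by
    rw [hL, Finset.card_insert_of_notMem (by simp [hab, ha]), Finset.card_insert_of_notMem hb]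
  have h := eq_zero_of_cyclic_relations K L S.card (Finset.card_ne_zero.2 hS) hcard
    (fun a b => shuffleIns K ((L.erase a).erase b) (fun l => φ (b :: a :: l)) w)
    (fun x a b => shuffleIns K (((L.erase a).erase b).erase x)
      (fun l => φ (b :: a :: x :: l)) w) ?_ ?_ ?_ a (by simp [hL]) b (by simp [hL])
  · rwa [hL, Finset.erase_insert (by simp [hab, ha]), Finset.erase_insert hb] at h
  · intro a b
    rw [Finset.erase_right_comm, ← Pi.neg_apply, ← shuffleIns_neg]
    congr 1
    funext l
    exact hanti a b l
  · intro a' ha' b' hb' hab'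
    have hb'' : b' ∈ L.erase a' := Finset.mem_erase.2 ⟨hab'.symm, hb'⟩
    refine hsplit _ a' b' (Finset.card_pos.1 ?_) (by simp) (by simp) hab' ?_
    · have := hS.card_pos
      rw [Finset.card_erase_of_mem hb'', Finset.card_erase_of_mem ha']
      omega
    · rw [Finset.insert_erase hb'', Finset.insert_erase ha']
  · intro a ha b hb x hx hab hbx hxa
    have hT : (L.erase a).erase b = insert x (((L.erase a).erase b).erase x) := by
      rw [Finset.insert_erase (by simp [hx, hbx.symm, hxa])]
    have e1 : ((L.erase b).erase x).erase a = ((L.erase a).erase b).erase x := by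
      ext; simp only [Finset.mem_erase]; tauto
    have e2 : ((L.erase x).erase a).erase b = ((L.erase a).erase b).erase x := by
      ext; simp only [Finset.mem_erase]; tauto
    rw [e1, e2, hT, ← shuffleIns_ins K (Finset.notMem_erase _ _), Finset.erase_insert_eq_erase,
      Finset.erase_idem, ← Pi.add_apply, ← shuffleIns_add]
    congr 1
    funext l
    exact hrel a b x l

include hrel in
/-- If the shuffles of `S ∪ {y}` into `w` followed by two letters are killed by `φ`, so are the
shuffles of `S` into `w` followed by three letters: by `hrel` the latter are invariant under
cyclic rotation of the three letters and equal to the sum of their three rotations. -/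
lemma shuffleIns_eq_zero_of_insert (w : List Y) (S : Finset Y) (a b y : Y)
    (h : ∀ a' b' y', [a', b', y'].Perm [a, b, y] →
      y' ∉ S ∧ shuffleIns K (insert y' S) (fun l => φ (b' :: a' :: l)) w = 0) :
    shuffleIns K S (fun l => φ (b :: a :: y :: l)) w = 0 := by
  have key (a' b' y' : Y) (hp : [a', b', y'].Perm [a, b, y]) :
      shuffleIns K S (fun l => φ (y' :: b' :: a' :: l)) w +
        shuffleIns K S (fun l => φ (a' :: y' :: b' :: l)) w = 0 := by
    obtain ⟨hy, h0⟩ := h a' b' y' hp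
    rw [← shuffleIns_ins K hy] at h0
    rw [← h0, ← Pi.add_apply, ← shuffleIns_add]
    congr 1
    funext l
    exact (hrel a' b' y' l).symm
  have h1 := key a b y (List.Perm.refl _)
  have h2 := key b y a (by
    exact (List.perm_append_comm (l₁ := [b, y]) (l₂ := [a])))
  have h3 := key y a b (by
    exact (List.perm_append_comm (l₁ := [y]) (l₂ := [a, b])))
  set A := shuffleIns K S (fun l => φ (b :: a :: y :: l)) w
  set B := shuffleIns K S (fun l => φ (y :: b :: a :: l)) w
  set C := shuffleIns K S (fun l => φ (a :: y :: b :: l)) w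
  have h4 : (2 : K) • A = 0 := by
    rw [two_smul, ← sub_zero (A + A), ← h1, show A + A - (B + C) = (C + A) + (A + B) - (B + C) -
      (B + C) by abel]
    rw [h1, h2, h3]; simp
  exact (smul_eq_zero.1 h4).resolve_left two_ne_zero

include hanti hrel in
/-- The last letters of a shuffle of `S` into `w`, followed by `a` and `b`, are elements of `S`
or the last letter of `w`; the latter contribution vanishes by induction on `w`, and the former
ones satisfy the linear system of `eq_zero_of_cyclic_relations`. -/
lemma shuffleIns_eq_zero (w : List Y) : ∀ (S : Finset Y) (a b : Y), S.Nonempty → w.Nodup →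
    a ∉ S → b ∉ S → a ≠ b → (∀ y ∈ w, y ∉ S ∧ y ≠ a ∧ y ≠ b) →
    shuffleIns K S (fun l => φ (b :: a :: l)) w = 0 := by
  induction w with
  | nil =>
    intro S a b hS _ ha hb hab _
    refine shuffleIns_eq_zero_of_split K φ hanti hrel [] S a b hS ha hb hab ?_
    intro T a' b' hT _ _ _ _
    exact shuffleIns_nil K hT _
  | cons y w ih =>
    intro S a b hS hw ha hb hab hd
    refine shuffleIns_eq_zero_of_split K φ hanti hrel (y :: w) S a b hS ha hb hab ?_
    intro T a' b' _ ha' hb' hab' hT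
    have hy : y ∉ insert a' (insert b' T) := by
      rw [hT]
      simpa [not_or, and_comm, and_assoc] using hd y (by simp)
    have hd' : ∀ z ∈ w, z ∉ insert y (insert a' (insert b' T)) := by
      intro z hz
      rw [hT]
      have h1 := hd z (by simp [hz])
      have h2 : z ≠ y := by rintro rfl; exact (List.nodup_cons.1 hw).1 hz
      simpa [not_or] using ⟨h2, h1.2.1, h1.2.2, h1.1⟩
    rw [shuffleIns_cons, add_eq_right]
    refine shuffleIns_eq_zero_of_insert K φ hrel w T a' b' y ?_
    intro p q r hp
    simp only [Finset.mem_insert, not_or] at hy hd'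
    have hn : [p, q, r].Nodup := hp.nodup_iff.2 (by
      simp only [List.nodup_cons, List.mem_cons, List.not_mem_nil, List.nodup_nil]; grind)
    have hm (z : Y) : z ∈ [p, q, r] ↔ z ∈ [a', b', y] := hp.mem_iff
    have hout (z : Y) (hz : z ∈ [p, q, r]) : z ∉ T ∧ z ∉ w := by
      rw [hm] at hz; grind
    have hr := hout r (by simp)
    refine ⟨hr.1, ih _ p q (Finset.insert_nonempty _ _) (List.nodup_cons.1 hw).2 ?_ ?_ ?_ ?_⟩
    · have := hout p (by simp); grind
    · have := hout q (by simp); grind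
    · grind
    · intro z hz
      have hp := (hout p (by simp)).2
      have hq := (hout q (by simp)).2
      have hr := hout r (by simp)
      grind

include hanti hrel in
/-- A function on lists that is alternating in the last two letters and satisfies the insertion
relation vanishes on all lists of at least three distinct letters. -/
theorem eq_zero_of_insertion_relation (w : List Y) (a b y : Y) (h : (b :: a :: y :: w).Nodup) :
    φ (b :: a :: y :: w) = 0 := by
  refine shuffleIns_eq_zero_of_insert K φ hrel w ∅ a b y ?_
  intro p q r hp
  have hn : ([p, q, r] ++ w).Nodup := by
    exact ((hp.trans (List.Perm.swap b a [y])).append_right w).nodup_iff.2 h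
  refine ⟨Finset.notMem_empty r, shuffleIns_eq_zero K φ hanti hrel w _ p q (by simp) ?_ ?_ ?_ ?_ ?_⟩
  all_goals
    simp only [List.cons_append, List.nil_append, List.nodup_cons, List.mem_cons] at hn
    grind

end Vanishing

/-! ### Koszul signs -/

section Koszul

variable {K Y M : Type*} [Field K] [AddCommGroup M] [Module K M] [LinearOrder Y]

/-- The sign prescribed by the commutation factor `s` for moving `b` past all letters of `w` that
are larger than `b`. -/
def koszulStep (s : Y → Y → K) (b : Y) (w : List Y) : K :=
  (w.map fun a => if b < a then s a b else 1).prod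

/-- The Koszul sign of a word (read from right to left): the product of `s a b` over all pairs of
letters `b < a` of which `a` comes first. -/
def koszul (s : Y → Y → K) : List Y → K
  | [] => 1
  | b :: w => koszulStep s b w * koszul s w

variable (s : Y → Y → K)

lemma koszulStep_cons (b a : Y) (w : List Y) :
    koszulStep s b (a :: w) = (if b < a then s a b else 1) * koszulStep s b w := by
  simp [koszulStep]

lemma koszulStep_perm (b : Y) {w w' : List Y} (h : w.Perm w') :
    koszulStep s b w = koszulStep s b w' :=
  (h.map _).prod_eq

variable (hs : ∀ a b, s a b = s b a) (hs1 : ∀ a b, s a b * s a b = 1)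

include hs1 in
lemma koszulStep_ne_zero (b : Y) (w : List Y) : koszulStep s b w ≠ 0 := by
  have h (a : Y) : s a b ≠ 0 := left_ne_zero_of_mul_eq_one (hs1 a b)
  induction w with
  | nil => simp [koszulStep]
  | cons a w ih =>
    rw [koszulStep_cons]
    split_ifs <;> simp [ih, h]

include hs1 in
lemma koszul_ne_zero (w : List Y) : koszul s w ≠ 0 := by
  induction w with
  | nil => exact one_ne_zero
  | cons b w ih => exact mul_ne_zero (koszulStep_ne_zero s hs1 b w) ih

include hs hs1 in
lemma koszul_swap {a b : Y} (hab : a ≠ b) (w : List Y) :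
    koszul s (b :: a :: w) = s a b * koszul s (a :: b :: w) := by
  have h1 := hs1 a b
  have h2 := hs a b
  simp only [koszul, koszulStep_cons]
  rcases hab.lt_or_gt with h | h
  · simp only [h, not_lt_of_gt h, if_true, if_false]
    grind
  · simp only [h, not_lt_of_gt h, if_true, if_false]
    grind

include hs hs1 in
/-- Multiplication by Koszul signs turns weighted insertions into unweighted ones. -/
lemma ins_koszul (x : Y) (F : List Y → M) (w : List Y) (hx : x ∉ w) :
    ins₁ K x (fun l => koszul s l • F l) w = koszul s (x :: w) • ins s x F w := by
  induction w generalizing F with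
  | nil => rfl
  | cons y w ih =>
    rw [List.mem_cons, not_or] at hx
    have h : ins₁ K x (fun l => koszul s (y :: l) • F (y :: l)) w =
        koszulStep s y (x :: w) • ins₁ K x (fun l => koszul s l • F (y :: l)) w := by
      rw [← LinearMap.lsmul_apply (R := K), ← ins_map]
      refine ins_congr _ _ _ _ _ fun l hl => ?_
      rw [koszul, koszulStep_perm s y hl, mul_smul]
      rfl
    have h' : koszul s (y :: x :: w) = s x y * koszul s (x :: y :: w) :=
      koszul_swap s hs hs1 hx.1 w
    simp only [ins₁, ins, one_smul] at h ih ⊢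
    rw [h, ih _ hx.2, smul_smul, smul_add, smul_smul, mul_comm _ (s x y), ← h']
    rfl

include hs hs1 in
/-- The variant of `ins_koszul` for insertions into a word that is followed by the letters `a` and
`b`, which `x` has to pass. -/
lemma ins_koszul_cons_cons (a b x : Y) (F : List Y → M) (w : List Y)
    (h : (b :: a :: x :: w).Nodup) :
    ins₁ K x (fun l => koszul s (b :: a :: l) • F l) w =
      (s x b * s x a * koszul s (x :: b :: a :: w)) • ins s x F w := by
  have h1 : ins₁ K x (fun l => koszul s (b :: a :: l) • F l) w =
      (koszulStep s b (a :: x :: w) * koszulStep s a (x :: w)) •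
        ins₁ K x (fun l => koszul s l • F l) w := by
    rw [← LinearMap.lsmul_apply (R := K), ← ins_map]
    refine ins_congr _ _ _ _ _ fun l hl => ?_
    rw [koszul, koszul, koszulStep_perm s b (hl.cons a), koszulStep_perm s a hl,
      LinearMap.lsmul_apply, smul_smul, mul_assoc]
  simp only [List.nodup_cons, List.mem_cons, not_or] at h
  rw [h1, ins_koszul s hs hs1 x F w h.2.2.1, smul_smul]
  congr 1
  have e1 : koszul s (a :: x :: w) = s x a * koszul s (x :: a :: w) :=
    koszul_swap s hs hs1 (Ne.symm h.2.1.1) w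
  have e2 := koszul_swap s hs hs1 (Ne.symm h.1.2.1) (a :: w)
  have e3 := koszulStep_perm s b (List.Perm.swap x a w)
  rw [koszul.eq_2 s b] at e2
  rw [koszul.eq_2 s a] at e1
  grind

end Koszul

/-! ### Brackets with a letter -/

section Letter

variable (K : Type*) {X : Type*} [Field K]

/-- The word with last letter `b` whose other letters, from right to left, form the given list. -/
def ofList : X → List X → Word X
  | b, [] => .letter b
  | b, a :: w => .snoc (ofList a w) b

/-- The basis element of `Zin K X` given by a list of letters, read from right to left. The empty
list has no corresponding word and is sent to `0`. -/
noncomputable def listWord : List X → Zin K X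
  | [] => 0
  | b :: w => word K (ofList b w)

variable (par : X → ZMod 2)

/-- The commutation factor of two letters. -/
def letterSgn (a b : X) : K := sgn K (par a) (par b)

lemma letterSgn_comm (a b : X) : letterSgn K par a b = letterSgn K par b a := sgn_comm K _ _

lemma letterSgn_mul_self (a b : X) : letterSgn K par a b * letterSgn K par a b = 1 :=
  sgn_mul_self K _ _

/-- The commutation factor of a letter and a list of letters. -/
def listSgn (x : X) (w : List X) : K := (w.map (letterSgn K par x)).prod

lemma listSgn_cons (x a : X) (w : List X) :
    listSgn K par x (a :: w) = letterSgn K par x a * listSgn K par x w := by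
  simp [listSgn]

lemma listSgn_mul_self (x : X) (w : List X) : listSgn K par x w * listSgn K par x w = 1 := by
  induction w with
  | nil => simp [listSgn]
  | cons a w ih =>
    have h := letterSgn_mul_self K par x a
    rw [listSgn_cons]
    grind

lemma sgn_parity_ofList (x b : X) (w : List X) :
    sgn K (par x) ((ofList b w).parity par) = listSgn K par x (b :: w) := by
  induction w generalizing b with
  | nil => simp [ofList, Word.parity, listSgn, letterSgn]
  | cons a w ih =>
    rw [ofList, Word.parity, sgn_add_right, ih, listSgn_cons K par x b, mul_comm]; rfl

lemma append_listWord (b a : X) (w : List X) :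
    append K b (listWord K (a :: w)) = listWord K (b :: a :: w) :=
  append_word K _ _

/-- The antisymmetrization `w a b - (-1)^{|a||b|} w b a` in the last two letters of a word, given
as a list from right to left; it is set to `0` on lists with fewer than two letters. -/
noncomputable def antisymm : List X → Zin K X
  | b :: a :: w => listWord K (b :: a :: w) - letterSgn K par a b • listWord K (a :: b :: w)
  | _ => 0

lemma antisymm_swap (a b : X) (w : List X) :
    antisymm K par (b :: a :: w) = -letterSgn K par a b • antisymm K par (a :: b :: w) := by
  have h := letterSgn_mul_self K par a b
  rw [antisymm, antisymm, letterSgn_comm K par b a, neg_smul, smul_sub, smul_smul, h, one_smul]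
  abel

lemma ins_listWord_cons (s : X → X → K) (x a : X) (w : List X) :
    ins s x (fun l => listWord K (a :: l)) w = append K a (ins s x (listWord K) w) := by
  rw [← ins_map]
  refine ins_congr _ _ _ _ _ fun l hl => ?_
  cases l with
  | nil => simp at hl
  | cons c l => exact (append_listWord K a c l).symm

/-- The product `x ∘ (w b)` is obtained by inserting `x` into `w`. The factor in front accounts for
the weights in `ins`, which measure the letters to the right of `x` instead of those to its left. -/
lemma mulWord_letter (x b : X) (w : List X) :
    mulWord K par (.letter x) (ofList b w) =
      listSgn K par x w • append K b (ins (letterSgn K par) x (listWord K) w) := by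
  induction w generalizing b with
  | nil =>
    rw [ofList, mulWord, ← append_word]
    simp [listSgn, ins, listWord, ofList]
  | cons a w ih =>
    have h := letterSgn_mul_self K par x a
    have e : mulWord K par (ofList a w) (.letter x) = listWord K (x :: a :: w) := by
      rw [mulWord]; rfl
    rw [ofList, mulWord, ih, Word.parity, sgn_parity_ofList, e, ins,
      ins_listWord_cons, listSgn_cons]
    simp only [map_add, map_smul]
    match_scalars <;> grind

lemma superCommutator_word (u v : Word X) :
    superCommutator K par (word K u) (word K v) =
      mulWord K par u v - sgn K (u.parity par) (v.parity par) • mulWord K par v u := by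
  simp [superCommutator, word, Finsupp.linearCombination_single]

lemma superCommutator_listWord_letter (x b a : X) (w : List X) :
    superCommutator K par (listWord K (b :: a :: w)) (word K (.letter x)) =
      listWord K (x :: b :: a :: w) - letterSgn K par x b • listWord K (b :: x :: a :: w) -
        (letterSgn K par x b * letterSgn K par x a) •
          append K b (append K a (ins (letterSgn K par) x (listWord K) w)) := by
  have h := listSgn_mul_self K par x w
  have ha := letterSgn_mul_self K par x a
  have e : mulWord K par (ofList b (a :: w)) (.letter x) = listWord K (x :: b :: a :: w) := by
    rw [mulWord]; rfl
  rw [listWord, superCommutator_word, e, mulWord_letter, Word.parity, sgn_comm, sgn_parity_ofList,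
    ins, ins_listWord_cons, listSgn_cons, listSgn_cons, map_add, append_listWord, map_smul]
  match_scalars <;> grind

/-- The bracket of `w a b - (-1)^{|a||b|} w b a` with a letter `x`. -/
lemma superCommutator_antisymm_letter (x b a : X) (w : List X) :
    superCommutator K par (antisymm K par (b :: a :: w)) (word K (.letter x)) =
      antisymm K par (x :: b :: a :: w) -
        letterSgn K par a b • antisymm K par (x :: a :: b :: w) -
        (letterSgn K par x b * letterSgn K par x a) •
          ins (letterSgn K par) x (fun l => antisymm K par (b :: a :: l)) w := by
  have h : ins (letterSgn K par) x (fun l => antisymm K par (b :: a :: l)) w =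
      append K b (append K a (ins (letterSgn K par) x (listWord K) w)) - letterSgn K par a b •
        append K a (append K b (ins (letterSgn K par) x (listWord K) w)) := by
    let T : Zin K X →ₗ[K] Zin K X := append K b ∘ₗ append K a -
      letterSgn K par a b • append K a ∘ₗ append K b
    change _ = T _
    rw [← ins_map]
    refine ins_congr _ _ _ _ _ fun l hl => ?_
    cases l with
    | nil => simp at hl
    | cons c l =>
      change antisymm K par (b :: a :: c :: l) =
        append K b (append K a (listWord K (c :: l))) - letterSgn K par a b •
          append K a (append K b (listWord K (c :: l)))
      simp only [append_listWord, antisymm]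
  have hab := letterSgn_comm K par a b
  have hxa := letterSgn_comm K par a x
  have hxb := letterSgn_comm K par b x
  rw [h]
  simp only [antisymm, map_sub, map_smul, LinearMap.sub_apply, LinearMap.smul_apply,
    superCommutator_listWord_letter]
  match_scalars <;> grind

end Letter

/-! ### Antisymmetrized words are brackets -/

section Generation

variable (K : Type*) {X : Type*} [Field K] (par : X → ZMod 2)

lemma word_letter_mem_ST (x : X) : word K (.letter x) ∈ ST K par :=
  Submodule.mem_sInf.2 fun _ hS => hS.1 x

lemma superCommutator_mem_ST {f g : Zin K X} (hf : f ∈ ST K par) (hg : g ∈ ST K par) :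
    superCommutator K par f g ∈ ST K par := by
  refine Submodule.mem_sInf.2 fun S hS => hS.2 f g ?_ ?_
  · exact Submodule.mem_sInf.1 hf S hS
  · exact Submodule.mem_sInf.1 hg S hS

/-- The antisymmetrized words of length `n + 1` are obtained from those of length `n` by brackets
with letters. Modulo `ST`, brackets with letters impose the insertion relation on the
antisymmetrized words of length `n + 1`, once positions are labelled and Koszul signs are
multiplied in. -/
lemma antisymm_mem_ST_succ [CharZero K] (n : ℕ) (hn : 2 ≤ n)
    (ih : ∀ l : List X, l.length = n → antisymm K par l ∈ ST K par)
    (L : List X) (hL : L.length = n + 1) : antisymm K par L ∈ ST K par := by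
  let ℓ : Fin L.length → X := L.get
  let s : Fin L.length → Fin L.length → K := fun a b => letterSgn K par (ℓ a) (ℓ b)
  have hs : ∀ a b, s a b = s b a := fun a b => letterSgn_comm K par _ _
  have hs1 : ∀ a b, s a b * s a b = 1 := fun a b => letterSgn_mul_self K par _ _
  -- The values of `φ` on lists that do not use every position exactly once are set to `0`, so that
  -- the insertion relation holds for all lists.
  let I : List (Fin L.length) := List.finRange L.length
  let q : List (Fin L.length) → Zin K X ⧸ ST K par :=
    fun l => (ST K par).mkQ (antisymm K par (l.map ℓ))
  let φ : List (Fin L.length) → Zin K X ⧸ ST K par :=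
    fun l => if l.Perm I then koszul s l • q l else 0
  have hφ {l l' : List (Fin L.length)} (h : l.Perm l') (hl' : l'.Perm I) :
      φ l = koszul s l • q l := if_pos (h.trans hl')
  have hφ0 {l l' : List (Fin L.length)} (h : l.Perm l') (hl' : ¬ l'.Perm I) : φ l = 0 :=
    if_neg fun hl => hl' (h.symm.trans hl)
  have hnodup {l : List (Fin L.length)} (h : l.Perm I) : l.Nodup :=
    h.nodup_iff.2 (List.nodup_finRange _)
  have hq (a b w) : q (b :: a :: w) = -s a b • q (a :: b :: w) := by
    simp only [q, List.map_cons]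
    rw [antisymm_swap, map_smul]
  have hanti (a b w) : φ (b :: a :: w) = -φ (a :: b :: w) := by
    by_cases h : (a :: b :: w).Perm I
    · have hab : a ≠ b := by have := hnodup h; simp at this; tauto
      rw [hφ (List.Perm.swap a b w) h, hφ (List.Perm.refl _) h, koszul_swap s hs hs1 hab, hq,
        smul_smul, ← neg_smul]
      congr 1
      have := hs1 a b
      grind
    · rw [hφ0 (List.Perm.swap a b w) h, hφ0 (List.Perm.refl _) h, neg_zero]
  -- The bracket of an antisymmetrized word with a letter vanishes modulo `ST`.
  have hbr (a b x w) (h : (x :: b :: a :: w).Perm I) :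
      (s x b * s x a) • ins s x (fun l => q (b :: a :: l)) w =
        q (x :: b :: a :: w) - s a b • q (x :: a :: b :: w) := by
    have hlen : (b :: a :: w).length = n := by
      have := h.length_eq
      simp only [I, List.length_finRange, hL, List.length_cons] at this
      simp only [List.length_cons]; omega
    have hmem := superCommutator_mem_ST K par (ih ((b :: a :: w).map ℓ) (by simpa using hlen))
      (word_letter_mem_ST K par (ℓ x))
    rw [List.map_cons, List.map_cons, superCommutator_antisymm_letter,
      ← Submodule.Quotient.mk_eq_zero, ← Submodule.mkQ_apply, map_sub, map_sub, map_smul, map_smul,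
      sub_eq_zero, ← ins_map, ← ins_comp_map] at hmem
    exact hmem.symm
  have hrel (a b x w) : ins₁ K x (fun l => φ (b :: a :: l)) w =
      φ (x :: b :: a :: w) + φ (a :: x :: b :: w) := by
    have p1 : (b :: a :: x :: w).Perm (x :: b :: a :: w) :=
      ((List.Perm.swap x a w).cons b).trans (List.Perm.swap x b _)
    have p2 : (a :: x :: b :: w).Perm (x :: b :: a :: w) :=
      (List.Perm.swap x a _).trans ((List.Perm.swap b a w).cons x)
    by_cases h : (x :: b :: a :: w).Perm I
    · have hd := hnodup h
      simp only [List.nodup_cons, List.mem_cons, not_or] at hd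
      have e1 : ins₁ K x (fun l => φ (b :: a :: l)) w =
          ins₁ K x (fun l => koszul s (b :: a :: l) • q (b :: a :: l)) w :=
        ins_congr _ _ _ _ _ fun l hl => hφ (((hl.cons a).cons b).trans p1) h
      rw [e1, ins_koszul_cons_cons s hs hs1 a b x (fun l => q (b :: a :: l)) w
        (hnodup (p1.trans h)), mul_comm, mul_smul, hbr a b x w h, hφ (List.Perm.refl _) h,
        hφ p2 h, hq x a, koszul_swap s hs hs1 hd.1.2.1]
      have e2 : koszul s (x :: a :: b :: w) = s a b * koszul s (x :: b :: a :: w) := by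
        rw [koszul.eq_2, koszul_swap s hs hs1 hd.2.1.1, koszulStep_perm s x (List.Perm.swap b a w),
          hs b a, mul_left_comm, ← koszul.eq_2]
      have h1 := hs1 x a
      have h2 := hs x a
      rw [e2]
      match_scalars <;> grind
    · rw [hφ0 (List.Perm.refl _) h, hφ0 p2 h, add_zero]
      have e1 : ins₁ K x (fun l => φ (b :: a :: l)) w =
          ins₁ K x (fun l => (0 : Zin K X ⧸ ST K par →ₗ[K] Zin K X ⧸ ST K par) (q l)) w :=
        ins_congr _ _ _ _ _ fun l hl => hφ0 (((hl.cons a).cons b).trans p1) h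
      rw [e1, ins₁, ins_map, LinearMap.zero_apply]
  have h0 : φ I = 0 := by
    have hlen : I.length = n + 1 := by simp [I, hL]
    have hd : I.Nodup := List.nodup_finRange _
    generalize I = J at hlen hd ⊢
    match J, hlen, hd with
    | b :: a :: y :: w, _, hd => exact eq_zero_of_insertion_relation K φ hanti hrel w a b y hd
    | [_, _], h, _ => simp at h; omega
    | [_], h, _ => simp at h; omega
  rw [hφ (List.Perm.refl _) (List.Perm.refl _), smul_eq_zero] at h0
  have h1 := h0.resolve_left (koszul_ne_zero s hs1 _)
  simp only [q, I, ℓ, List.map_get_finRange] at h1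
  rwa [Submodule.mkQ_apply, Submodule.Quotient.mk_eq_zero] at h1

end Generation

/-! ### Elements of `ST` are antisymmetric in the last two letters -/

section Antisymmetry

variable (K : Type*) {X : Type*} [Field K] (par : X → ZMod 2)

/-- The shuffle of a word `u` into the part of a word that precedes its last two letters; it is
set to `0` on single letters. -/
noncomputable def innerShuffleWord (u : Word X) : Word X → Zin K X
  | .letter _ => 0
  | .snoc (.letter c) d => append K d (append K c (word K u))
  | .snoc (.snoc v c) d => append K d (append K c
      (mulWord K par u v + sgn K (u.parity par) (v.parity par) • mulWord K par v u))

/-- The bilinear extension of `innerShuffleWord`. -/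
noncomputable def innerShuffle : Zin K X →ₗ[K] Zin K X →ₗ[K] Zin K X :=
  Finsupp.linearCombination K fun u => Finsupp.linearCombination K (innerShuffleWord K par u)

/-- The bilinear operation `innerShuffle` with its arguments interchanged, with the sign of that
interchange. -/
noncomputable def innerShuffleSwap : Zin K X →ₗ[K] Zin K X →ₗ[K] Zin K X :=
  Finsupp.linearCombination K fun u => Finsupp.linearCombination K fun v =>
    sgn K (u.parity par) (v.parity par) • innerShuffleWord K par v u

lemma innerShuffle_word (u v : Word X) :
    innerShuffle K par (word K u) (word K v) = innerShuffleWord K par u v := by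
  simp [innerShuffle, word, Finsupp.linearCombination_single]

lemma innerShuffleSwap_word (u v : Word X) :
    innerShuffleSwap K par (word K u) (word K v) =
      sgn K (u.parity par) (v.parity par) • innerShuffleWord K par v u := by
  simp [innerShuffleSwap, word, Finsupp.linearCombination_single]

lemma p_word (w : Word X) : p K par (word K w) = pWord K par w := by
  simp [p, word, Finsupp.linearCombination_single]

lemma p_append_letter (x y : X) : p K par (append K y (word K (.letter x))) =
    letterSgn K par x y • append K x (word K (.letter y)) := by
  rw [append_word, append_word, p_word, pWord]; rfl

lemma p_append_append (y z : X) (f : Zin K X) : p K par (append K z (append K y f)) =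
    letterSgn K par y z • append K y (append K z f) := by
  have h : p K par ∘ₗ append K z ∘ₗ append K y =
      letterSgn K par y z • append K y ∘ₗ append K z := lin_ext K fun w => by
    simp only [LinearMap.comp_apply, LinearMap.smul_apply, append_word, p_word, pWord]; rfl
  exact LinearMap.congr_fun h f

/-- The terms of `[u, v]` whose last two letters come from different factors occur in
antisymmetric pairs. So the failure of `[u, v]` to be antisymmetric in the last two letters is
determined by the corresponding failures for `u` and `v`. -/
lemma p_superCommutator_add (f g : Zin K X) :
    p K par (superCommutator K par f g) + superCommutator K par f g =
      innerShuffle K par f (p K par g + g) - innerShuffleSwap K par (p K par f + f) g := by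
  let T : Zin K X →ₗ[K] Zin K X := p K par + LinearMap.id
  let E : Zin K X →ₗ[K] Zin K X →ₗ[K] Zin K X := (innerShuffle K par).compl₁₂ LinearMap.id T
  let E' : Zin K X →ₗ[K] Zin K X →ₗ[K] Zin K X := (innerShuffleSwap K par).compl₁₂ T LinearMap.id
  have h : (superCommutator K par).compr₂ T + E' = E := by
    refine lin_ext K fun u => lin_ext K fun v => ?_
    change p K par (superCommutator K par (word K u) (word K v)) +
      superCommutator K par (word K u) (word K v) +
        innerShuffleSwap K par (p K par (word K u) + word K u) (word K v) =
          innerShuffle K par (word K u) (p K par (word K v) + word K v)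
    rw [superCommutator_word]
    have hs (i j : ZMod 2) := sgn_mul_self K i j
    have hc (i j : ZMod 2) := sgn_comm K i j
    -- The bilinear maps are evaluated on words before words are rewritten as values of `append`.
    rcases u with x | ⟨x | ⟨u, a⟩, b⟩ <;> rcases v with y | ⟨y | ⟨v, c⟩, d⟩ <;>
    simp only [p_word, pWord, map_add, map_smul, map_neg, LinearMap.add_apply,
      LinearMap.neg_apply, LinearMap.smul_apply, innerShuffle_word, innerShuffleSwap_word,
      innerShuffleWord] <;>
    simp only [mulWord, map_add, map_sub, map_smul, Word.parity, ← append_word, p_append_letter,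
      p_append_append, letterSgn, sgn_add_left, sgn_add_right, smul_zero] <;>
    match_scalars <;> grind
  exact eq_sub_of_add_eq (LinearMap.congr_fun (LinearMap.congr_fun h f) g)

lemma p_eq_neg_of_mem_ST {f : Zin K X} (hf : f ∈ ST K par) : p K par f = -f := by
  have h : ST K par ≤ LinearMap.ker (p K par + LinearMap.id) := by
    refine sInf_le ⟨fun x => ?_, fun a b ha hb => ?_⟩
    · simp [p_word, pWord]
    · simp only [LinearMap.mem_ker, LinearMap.add_apply, LinearMap.id_apply] at ha hb ⊢
      rw [p_superCommutator_add, ha, hb]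
      simp
  exact eq_neg_of_add_eq_zero_left (h hf)

end Antisymmetry

/-! ### The criterion -/

section Criterion

variable {K X : Type*} [Field K] [CharZero K] (par : X → ZMod 2)

lemma antisymm_mem_ST (l : List X) : antisymm K par l ∈ ST K par := by
  induction hn : l.length generalizing l with
  | zero =>
    rw [List.length_eq_zero_iff] at hn
    subst hn
    exact zero_mem _
  | succ n ih =>
    rcases lt_or_ge n 2 with h | h
    · match l, hn with
      | [_], _ => exact zero_mem _
      | [b, a], _ =>
        have h := superCommutator_mem_ST K par (word_letter_mem_ST K par a)
          (word_letter_mem_ST K par b)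
        rw [superCommutator_word, mulWord, mulWord] at h
        exact h
      | _ :: _ :: _ :: _, hn => simp at hn; omega
    · exact antisymm_mem_ST_succ K par n h ih l hn

lemma exists_eq_ofList (w : Word X) : ∃ b l, w = ofList b l := by
  induction w with
  | letter x => exact ⟨x, [], rfl⟩
  | snoc w x ih =>
    obtain ⟨b, l, rfl⟩ := ih
    exact ⟨x, b :: l, rfl⟩

lemma word_sub_p_mem_ST (w : Word X) (hw : 1 < w.length) :
    word K w - p K par (word K w) ∈ ST K par := by
  obtain ⟨b, l, rfl⟩ := exists_eq_ofList w
  match l with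
  | [] => simp [ofList, Word.length] at hw
  | [a] =>
    have h := antisymm_mem_ST (K := K) par [b, a]
    rw [p_word]
    exact h
  | a :: c :: l =>
    have h := antisymm_mem_ST (K := K) par (b :: a :: c :: l)
    rw [p_word]
    exact h

lemma sub_p_mem_ST (f : Zin K X) (hf : ∀ w ∈ f.support, 1 < w.length) :
    f - p K par f ∈ ST K par := by
  have h : f - p K par f = f.sum fun w c => c • (word K w - p K par (word K w)) := by
    let T : Zin K X →ₗ[K] Zin K X := LinearMap.id - p K par
    change T f = _
    conv_lhs => rw [← Finsupp.sum_single f]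
    rw [map_finsuppSum]
    refine Finsupp.sum_congr fun w _ => ?_
    change T (Finsupp.single w (f w)) = f w • T (word K w)
    rw [← map_smul]
    simp [word]
  rw [h]
  exact Submodule.sum_mem _ fun w hw =>
    Submodule.smul_mem _ _ (word_sub_p_mem_ST par w (hf w hw))

end Criterion

end ZinbielSuper

theorem mainTheorem1 {K X : Type*} [Field K] [CharZero K] (par : X → ZMod 2)
    (n : ℕ) (hn : 1 < n) (f : ZinbielSuper.Zin K X)
    (hf : ZinbielSuper.IsHomogeneousOfDegree f n) :
    f ∈ ZinbielSuper.ST K par ↔ ZinbielSuper.p K par f = -f := by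
  refine ⟨ZinbielSuper.p_eq_neg_of_mem_ST K par, fun h => ?_⟩
  have hmem := ZinbielSuper.sub_p_mem_ST par f fun w hw => by rw [hf w hw]; exact hn
  rw [h, sub_neg_eq_add, ← two_smul K] at hmem
  exact (Submodule.smul_mem_iff _ two_ne_zero).1 hmem
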